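/- Let $\Bbbk$ be a field, let $n \ge 2$, and let $S = \Bbbk[x_1,\dots,x_n]$ with the standard grading. For $1 \le i \le n$ put $f_i = x_i x_{i+1}\cdots x_{i+n-3}$ (the product of $n-2$ consecutive variables, with indices taken modulo $n$ in $\{1,\dots,n\}$; for $n=2$ the empty product, $f_i = 1$), and let $$I_n = (f_1,f_2,\dots,f_n), \qquad J_n = (f_1,f_3,\dots,f_n),$$ so that $I_n$ is generated by all the $f_i$ and $J_n$ by all the $f_i$ with $i \ne 2$ (in particular $I_2=J_2=S$). Then for all integers $s,t \ge 0$ the ideals $$B_{n,s,t} = J_n^s I_n^t \quad\text{and}\quad C_{n,s,t} = J_n^s (x_1,x_n)^t$$ have linear free resolutions. Here an ideal $I$ of $S$ has a linear free resolution if, for some integer $d \ge 0$, there is an exact sequence of graded $S$-modules with degree-preserving maps $$\cdots \to S(-d-2)^{b_2} \to S(-d-1)^{b_1} \to S(-d)^{b_0} \to I \to 0$$ with all $b_i$ finite. -/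

import Mathlib

open MvPolynomial

noncomputable section

/-- A `d`-linear graded free resolution
`⋯ → S(-d-2)^{ι 2} → S(-d-1)^{ι 1} → S(-d)^{ι 0} → I → 0`
of an ideal `I` of the standard graded polynomial ring `S = K[x_j | j ∈ σ]`, written in
bases: each `ι i` is a finite basis of the `i`-th free module, the augmentation sends the basis
of the zeroth module to forms of degree `d` that generate `I`, and the differentials are matrices
all of whose entries are linear forms (or zero).  Such a resolution is automatically minimal. -/
structure LinearFreeResolution {K : Type*} [Field K] {σ : Type*}
    (I : Ideal (MvPolynomial σ K)) (d : ℕ) where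
  /-- basis of the `i`-th free module -/
  ι : ℕ → Type
  /-- the free modules have finite rank -/
  finite_rank : ∀ i, Fintype (ι i)
  /-- images in `I` of the basis elements of the zeroth free module -/
  gen : ι 0 → MvPolynomial σ K
  /-- matrix of the differential from the `(i+1)`-st to the `i`-th free module -/
  diff : ∀ i, Matrix (ι i) (ι (i + 1)) (MvPolynomial σ K)
  gen_isHomogeneous : ∀ a, (gen a).IsHomogeneous d
  diff_isHomogeneous : ∀ i a b, (diff i a b).IsHomogeneous 1
  span_gen : Ideal.span (Set.range gen) = I
  exact_zero : Function.Exact (diff 0).mulVecLin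
    (Fintype.linearCombination (MvPolynomial σ K) gen)
  exact_succ : ∀ i, Function.Exact (diff (i + 1)).mulVecLin (diff i).mulVecLin

/-- The ideal `I` has a linear free resolution: it has a `d`-linear one for some `d`. -/
def HasLinearFreeResolution {K : Type*} [Field K] {σ : Type*}
    (I : Ideal (MvPolynomial σ K)) : Prop :=
  ∃ d : ℕ, Nonempty (LinearFreeResolution I d)

/-- The product of the `n - 2` cyclically consecutive variables starting at the index `i`.
The variables `x_1, …, x_n` are indexed by `0, …, n - 1`, so that `pathMonomial K n i` is
`f_{i+1} = x_{i+1} x_{i+2} ⋯ x_{i+n-2}`, indices modulo `n`.  For `n = 2` it is `1`. -/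
def pathMonomial (K : Type*) [Field K] (n : ℕ) (i : Fin n) : MvPolynomial (Fin n) K :=
  ∏ k ∈ Finset.range (n - 2), X ⟨(i.val + k) % n, Nat.mod_lt _ i.pos⟩

/-- `I_n = (f_1, …, f_n)`, the `(n-2)`-path ideal of the `n`-cycle. -/
def pathIdealI (K : Type*) [Field K] (n : ℕ) : Ideal (MvPolynomial (Fin n) K) :=
  Ideal.span (Set.range (pathMonomial K n))

/-- `J_n = (f_1, f_3, …, f_n)`: the generator `f_2` (of index `1`) is left out. -/
def pathIdealJ (K : Type*) [Field K] (n : ℕ) : Ideal (MvPolynomial (Fin n) K) :=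
  Ideal.span (pathMonomial K n '' {i | i.val ≠ 1})

/-- `B_{n,s,t} = J_n^s I_n^t`. -/
def idealB (K : Type*) [Field K] (n s t : ℕ) : Ideal (MvPolynomial (Fin n) K) :=
  pathIdealJ K n ^ s * pathIdealI K n ^ t

/-- `C_{n,s,t} = J_n^s (x_1, x_n)^t`. -/
def idealC (K : Type*) [Field K] (n : ℕ) (hn : 2 ≤ n) (s t : ℕ) :
    Ideal (MvPolynomial (Fin n) K) :=
  pathIdealJ K n ^ s *
    Ideal.span {X (⟨0, by omega⟩ : Fin n), X (⟨n - 1, by omega⟩ : Fin n)} ^ t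

end

/-!
A monomial ideal with linear quotients has a linear resolution: the syzygies of `I + (m)` form an
extension of `I : m`, which is generated by variables, by the syzygies of `I`, and the horseshoe
lemma applies. Weakly polymatroidal sets of monomials, in decreasing lexicographic order, have
linear quotients.

The ideals `J_n^s I_n^t (x_1, x_n)^u` can be treated all at once. Each `f_i` is the complement of an
edge of the `n`-cycle, so a product of generators is recorded by a weight on the edges. If two such
monomials agree in the variables before `x_w` and the first has the smaller exponent at `x_w`, then
the difference of their weights alternates up to `w`. Comparing with the second weight therefore
shows that the alternating vector ending in `-1` at `w` can be added to the first, which raises the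
exponent at `x_w` only; the total is restored at one of the last two variables. If instead the edge
after `x_w` has positive weight and is not among the last, moving it one step further suffices.
-/

section LinearResolutions

variable {σ R : Type*} [CommRing R]

/-- Graded submodules of the free module `S^ι`, its basis being placed in one common degree. -/
def IsGradedSubmodule {ι : Type*} (M : Submodule (MvPolynomial σ R) (ι → MvPolynomial σ R)) :
    Prop :=
  ∀ r ∈ M, ∀ k, (fun i => homogeneousComponent k (r i)) ∈ M

theorem homogeneousComponent_add_mul_of_isHomogeneous {d : ℕ} {p : MvPolynomial σ R}
    (hp : p.IsHomogeneous d) (k : ℕ) (q : MvPolynomial σ R) :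
    homogeneousComponent (d + k) (p * q) = p * homogeneousComponent k q := by
  let := gradedAlgebra (σ := σ) (R := R)
  have h := DirectSum.coe_decompose_mul_add_of_left_mem (homogeneousSubmodule σ R) (j := k)
    (b := q) ((mem_homogeneousSubmodule d p).2 hp)
  exact (decomposition.decompose'_apply _ _).symm.trans
    (h.trans (congrArg (p * ·) (decomposition.decompose'_apply _ _)))

theorem isGradedSubmodule_ker {ι κ : Type*} [Fintype κ] {d : ℕ}
    {D : Matrix ι κ (MvPolynomial σ R)} (hD : ∀ i j, (D i j).IsHomogeneous d) :
    IsGradedSubmodule (LinearMap.ker D.mulVecLin) := by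
  intro r hr k
  rw [LinearMap.mem_ker] at hr ⊢
  ext1 i
  have h := congrArg (homogeneousComponent (d + k)) (congrFun hr i)
  simpa [Matrix.mulVec, dotProduct, homogeneousComponent_add_mul_of_isHomogeneous (hD _ _)] using h

/-- `M` is a graded submodule of `S^(α ⊕ β)` sitting in an exact sequence `0 → A → M → C → 0`
whose maps are the inclusion of `S^α` and the projection to `S^β`. -/
structure IsGradedExtension {α β : Type*}
    (M : Submodule (MvPolynomial σ R) (α ⊕ β → MvPolynomial σ R))
    (A : Submodule (MvPolynomial σ R) (α → MvPolynomial σ R))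
    (C : Submodule (MvPolynomial σ R) (β → MvPolynomial σ R)) : Prop where
  isGradedSubmodule : IsGradedSubmodule M
  mem_left : ∀ x, x ∈ A ↔ Sum.elim x 0 ∈ M
  mem_right : ∀ y, y ∈ C ↔ ∃ x, Sum.elim x y ∈ M

namespace IsGradedExtension

variable {α β κ κ' : Type*} [Fintype κ] [Fintype κ']
  {M : Submodule (MvPolynomial σ R) (α ⊕ β → MvPolynomial σ R)}
  {A : Submodule (MvPolynomial σ R) (α → MvPolynomial σ R)}
  {C : Submodule (MvPolynomial σ R) (β → MvPolynomial σ R)}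
  {DA : Matrix α κ (MvPolynomial σ R)} {DC : Matrix β κ' (MvPolynomial σ R)}
  {E : Matrix α κ' (MvPolynomial σ R)} {d : ℕ}

theorem exists_lift (h : IsGradedExtension M A C) (hDC : ∀ i j, (DC i j).IsHomogeneous d)
    (hC : LinearMap.range DC.mulVecLin ≤ C) :
    ∃ E : Matrix α κ' (MvPolynomial σ R), (∀ i j, (E i j).IsHomogeneous d) ∧
      ∀ y, Sum.elim (E.mulVec y) (DC.mulVec y) ∈ M := by
  classical
  have hcol : ∀ j, ∃ x : α → MvPolynomial σ R, (∀ i, (x i).IsHomogeneous d) ∧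
      Sum.elim x (DC.col j) ∈ M := by
    intro j
    obtain ⟨x, hx⟩ := (h.mem_right _).1 (hC ⟨Pi.single j 1, Matrix.mulVec_single_one DC j⟩)
    refine ⟨fun i => homogeneousComponent d (x i), fun i => homogeneousComponent_isHomogeneous _ _,
      ?_⟩
    convert h.isGradedSubmodule _ hx d using 1
    ext1 (i | i)
    · rfl
    · simp [homogeneousComponent_of_mem (hDC i j)]
  choose x hx hxM using hcol
  refine ⟨Matrix.of fun i j => x j i, fun i j => hx j i, fun y => ?_⟩
  have hsum : Sum.elim ((Matrix.of fun i j => x j i).mulVec y) (DC.mulVec y) =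
      ∑ j, y j • Sum.elim (x j) (DC.col j) := by
    ext1 (i | i) <;> simp [Matrix.mulVec, dotProduct, mul_comm]
  rw [hsum]
  exact M.sum_mem fun j _ => M.smul_mem _ (hxM j)

theorem range_fromBlocks (h : IsGradedExtension M A C) (hA : LinearMap.range DA.mulVecLin = A)
    (hC : LinearMap.range DC.mulVecLin = C)
    (hE : ∀ y, Sum.elim (E.mulVec y) (DC.mulVec y) ∈ M) :
    LinearMap.range (Matrix.fromBlocks DA E 0 DC).mulVecLin = M := by
  subst hA hC
  apply le_antisymm
  · rintro _ ⟨z, rfl⟩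
    have hx : Sum.elim (DA.mulVec (z ∘ Sum.inl)) 0 ∈ M := (h.mem_left _).1 ⟨_, rfl⟩
    simpa [Matrix.fromBlocks_mulVec, ← Sum.elim_add_add] using M.add_mem hx (hE (z ∘ Sum.inr))
  · intro r hr
    obtain ⟨p, q, rfl⟩ : ∃ p q, r = Sum.elim p q := ⟨_, _, (Sum.elim_comp_inl_inr r).symm⟩
    obtain ⟨y, rfl⟩ := (h.mem_right q).2 ⟨p, hr⟩
    obtain ⟨x, hx⟩ : p - E.mulVec y ∈ LinearMap.range DA.mulVecLin := by
      rw [h.mem_left]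
      simpa [← Sum.elim_sub_sub] using M.sub_mem hr (hE y)
    refine ⟨Sum.elim x y, ?_⟩
    rw [Matrix.mulVecLin_apply] at hx
    simp [Matrix.fromBlocks_mulVec, hx]

theorem ker_fromBlocks (h : IsGradedExtension M A C) (hA : LinearMap.range DA.mulVecLin = A)
    (hDA : ∀ i j, (DA i j).IsHomogeneous d) (hDC : ∀ i j, (DC i j).IsHomogeneous d)
    (hEd : ∀ i j, (E i j).IsHomogeneous d)
    (hE : ∀ y, Sum.elim (E.mulVec y) (DC.mulVec y) ∈ M) :
    IsGradedExtension (LinearMap.ker (Matrix.fromBlocks DA E 0 DC).mulVecLin)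
      (LinearMap.ker DA.mulVecLin) (LinearMap.ker DC.mulVecLin) where
  isGradedSubmodule := isGradedSubmodule_ker <| by
    rintro (i | i) (j | j)
    exacts [hDA i j, hEd i j, isHomogeneous_zero _ _ _, hDC i j]
  mem_left x := by
    simp [Matrix.fromBlocks_mulVec, ← Sum.elim_zero_zero, Sum.elim_eq_iff]
  mem_right y := by
    subst hA
    simp only [LinearMap.mem_ker, Matrix.mulVecLin_apply, Matrix.fromBlocks_mulVec,
      Sum.elim_comp_inl, Sum.elim_comp_inr, Matrix.zero_mulVec, zero_add, ← Sum.elim_zero_zero,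
      Sum.elim_eq_iff, exists_and_right, iff_and_self]
    intro hy
    obtain ⟨x, hx⟩ := (h.mem_left (E.mulVec y)).2 (hy ▸ hE y)
    exact ⟨-x, by rw [Matrix.mulVec_neg, ← hx, Matrix.mulVecLin_apply, neg_add_cancel]⟩

end IsGradedExtension

/-- `M ⊆ S^ι` has a resolution `0 → S(-d-k+1)^{b_{k-1}} → ⋯ → S(-d-1)^{b_1} → S(-d)^{b_0} → M → 0`
of length `k`.  The syzygies are described by kernels of matrices, so that the step from one syzygy
module to the next always has degree `1`, and `d` only enters in the first matrix. -/
def HasLinearResolutionOfLength : (k d : ℕ) → {ι : Type} →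
    Submodule (MvPolynomial σ R) (ι → MvPolynomial σ R) → Prop
  | 0, _, _, M => M = ⊥
  | k + 1, d, ι, M => ∃ (κ : Type) (_ : Fintype κ) (D : Matrix ι κ (MvPolynomial σ R)),
      (∀ i j, (D i j).IsHomogeneous d) ∧ LinearMap.range D.mulVecLin = M ∧
        HasLinearResolutionOfLength k 1 (LinearMap.ker D.mulVecLin)

namespace HasLinearResolutionOfLength

theorem succ {k d : ℕ} {ι : Type} {M : Submodule (MvPolynomial σ R) (ι → MvPolynomial σ R)}
    (h : HasLinearResolutionOfLength k d M) : HasLinearResolutionOfLength (k + 1) d M := by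
  induction k generalizing d ι with
  | zero =>
    obtain rfl : M = ⊥ := h
    refine ⟨Empty, inferInstance, 0, fun _ j => j.elim, ?_, Subsingleton.elim _ _⟩
    rw [Matrix.mulVecLin_zero, LinearMap.range_zero]
  | succ k ih =>
    obtain ⟨κ, _, D, hD, hM, hk⟩ := h
    exact ⟨κ, _, D, hD, hM, ih hk⟩

theorem mono {k l d : ℕ} {ι : Type} {M : Submodule (MvPolynomial σ R) (ι → MvPolynomial σ R)}
    (h : HasLinearResolutionOfLength k d M) (hkl : k ≤ l) : HasLinearResolutionOfLength l d M :=
  Nat.le_induction h (fun _ _ => succ) l hkl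

theorem of_isGradedExtension {k d : ℕ} {α β : Type}
    {M : Submodule (MvPolynomial σ R) (α ⊕ β → MvPolynomial σ R)}
    {A : Submodule (MvPolynomial σ R) (α → MvPolynomial σ R)}
    {C : Submodule (MvPolynomial σ R) (β → MvPolynomial σ R)}
    (hA : HasLinearResolutionOfLength k d A) (hC : HasLinearResolutionOfLength k d C)
    (h : IsGradedExtension M A C) : HasLinearResolutionOfLength k d M := by
  induction k generalizing d α β with
  | zero =>
    obtain rfl : A = ⊥ := hA
    obtain rfl : C = ⊥ := hC
    refine (Submodule.eq_bot_iff M).2 fun r hr => ?_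
    obtain ⟨x, y, rfl⟩ : ∃ x y, r = Sum.elim x y := ⟨_, _, (Sum.elim_comp_inl_inr r).symm⟩
    obtain rfl : y = 0 := (h.mem_right y).2 ⟨x, hr⟩
    obtain rfl : x = 0 := (h.mem_left x).2 hr
    exact Sum.elim_zero_zero
  | succ k ih =>
    obtain ⟨κ, _, DA, hDA, hrA, hkA⟩ := hA
    obtain ⟨κ', _, DC, hDC, hrC, hkC⟩ := hC
    obtain ⟨E, hEd, hE⟩ := h.exists_lift hDC hrC.le
    refine ⟨κ ⊕ κ', inferInstance, Matrix.fromBlocks DA E 0 DC, ?_,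
      h.range_fromBlocks hrA hrC hE, ih hkA hkC (h.ker_fromBlocks hrA hDA hDC hEd hE)⟩
    rintro (i | i) (j | j)
    exacts [hDA i j, hEd i j, isHomogeneous_zero _ _ _, hDC i j]

theorem exists_exact_sequence {k d : ℕ} {ι : Type}
    {M : Submodule (MvPolynomial σ R) (ι → MvPolynomial σ R)}
    (h : HasLinearResolutionOfLength k d M) :
    ∃ (κ : ℕ → Type) (_ : ∀ i, Fintype (κ i)) (D₀ : Matrix ι (κ 0) (MvPolynomial σ R))
      (D : ∀ i, Matrix (κ i) (κ (i + 1)) (MvPolynomial σ R)),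
      (∀ i j, (D₀ i j).IsHomogeneous d) ∧ (∀ n i j, (D n i j).IsHomogeneous 1) ∧
      LinearMap.range D₀.mulVecLin = M ∧ Function.Exact (D 0).mulVecLin D₀.mulVecLin ∧
      ∀ n, Function.Exact (D (n + 1)).mulVecLin (D n).mulVecLin := by
  induction k generalizing d ι with
  | zero =>
    obtain rfl : M = ⊥ := h
    refine ⟨fun _ => Empty, inferInstance, 0, 0, fun _ j => j.elim, fun _ i => i.elim, ?_, ?_, ?_⟩
    · rw [Matrix.mulVecLin_zero, LinearMap.range_zero]
    · exact LinearMap.exact_iff.2 (Subsingleton.elim _ _)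
    · exact fun _ => LinearMap.exact_iff.2 (Subsingleton.elim _ _)
  | succ k ih =>
    obtain ⟨κ₀, _, D₀, hD₀, hM, hker⟩ := h
    obtain ⟨κ, _, D₁, D, hD₁, hD, hrange, hexact, hexacts⟩ := ih hker
    refine ⟨fun | 0 => κ₀ | i + 1 => κ i, fun | 0 => inferInstance | i + 1 => inferInstance, D₀,
      fun | 0 => D₁ | i + 1 => D i, hD₀, fun | 0 => hD₁ | i + 1 => hD i, hM,
      LinearMap.exact_iff.2 hrange.symm, fun | 0 => hexact | i + 1 => hexacts i⟩

end HasLinearResolutionOfLength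

/-- An ideal of `S`, regarded as a submodule of the free module `S^1`. -/
noncomputable def idealToPi (I : Ideal (MvPolynomial σ R)) :
    Submodule (MvPolynomial σ R) (Unit → MvPolynomial σ R) :=
  Submodule.comap (LinearMap.proj ()) I

/-- The ideal `I` is generated in degree `d` and has a linear free resolution of finite length. -/
def HasLinearResolution (d : ℕ) (I : Ideal (MvPolynomial σ R)) : Prop :=
  ∃ k, HasLinearResolutionOfLength k d (idealToPi I)

theorem mem_iff_of_range_eq_idealToPi {κ : Type*} [Fintype κ]
    {D : Matrix Unit κ (MvPolynomial σ R)} {I : Ideal (MvPolynomial σ R)}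
    (h : LinearMap.range D.mulVecLin = idealToPi I) (p : MvPolynomial σ R) :
    p ∈ I ↔ ∃ y, D.mulVec y () = p := by
  have hp : p ∈ I ↔ Function.const Unit p ∈ LinearMap.range D.mulVecLin := by rw [h]; rfl
  exact hp.trans (exists_congr fun _ => funext_iff.trans Unique.forall_iff)

theorem HasLinearResolution.bot (d : ℕ) :
    HasLinearResolution d (⊥ : Ideal (MvPolynomial σ R)) := by
  refine ⟨0, (Submodule.eq_bot_iff (idealToPi (⊥ : Ideal (MvPolynomial σ R)))).2 fun r hr => ?_⟩
  exact funext fun _ => hr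

theorem fromCols_const_mulVec {κ : Type*} [Fintype κ] (D : Matrix Unit κ (MvPolynomial σ R))
    (m : MvPolynomial σ R) (z : κ ⊕ Unit → MvPolynomial σ R) :
    (Matrix.fromCols D (Matrix.of fun _ _ : Unit => m)).mulVec z =
      D.mulVec (z ∘ Sum.inl) + m • (z ∘ Sum.inr) := by
  rw [Matrix.fromCols_mulVec]
  congr 1
  ext1 _
  simp [Matrix.mulVec, dotProduct]

theorem range_fromCols_const {κ : Type*} [Fintype κ] {D : Matrix Unit κ (MvPolynomial σ R)}
    {I : Ideal (MvPolynomial σ R)} (h : LinearMap.range D.mulVecLin = idealToPi I)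
    (m : MvPolynomial σ R) :
    LinearMap.range (Matrix.fromCols D (Matrix.of fun _ _ : Unit => m)).mulVecLin =
      idealToPi (I ⊔ Ideal.span {m}) := by
  ext r
  change _ ↔ r () ∈ I ⊔ Ideal.span {m}
  simp only [Submodule.mem_sup, mem_iff_of_range_eq_idealToPi h, Ideal.mem_span_singleton',
    LinearMap.mem_range, Matrix.mulVecLin_apply, fromCols_const_mulVec, funext_iff,
    Unique.forall_iff]
  constructor
  · rintro ⟨z, hz⟩
    exact ⟨_, ⟨z ∘ Sum.inl, rfl⟩, _, ⟨z (Sum.inr ()), rfl⟩, by rw [mul_comm]; exact hz⟩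
  · rintro ⟨_, ⟨y, rfl⟩, _, ⟨c, rfl⟩, hr⟩
    exact ⟨Sum.elim y fun _ => c, by rw [← hr, mul_comm c]; rfl⟩

theorem isGradedExtension_ker_fromCols_const {κ : Type*} [Fintype κ] {d : ℕ}
    {D : Matrix Unit κ (MvPolynomial σ R)} {I : Ideal (MvPolynomial σ R)} {m : MvPolynomial σ R}
    (hD : ∀ i j, (D i j).IsHomogeneous d) (hm : m.IsHomogeneous d)
    (h : LinearMap.range D.mulVecLin = idealToPi I) :
    IsGradedExtension
      (LinearMap.ker (Matrix.fromCols D (Matrix.of fun _ _ : Unit => m)).mulVecLin)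
      (LinearMap.ker D.mulVecLin) (idealToPi (I.colon {m})) where
  isGradedSubmodule := isGradedSubmodule_ker <| by
    rintro i (j | _)
    exacts [hD i j, hm]
  mem_left x := by simp
  mem_right c := by
    change c () ∈ I.colon {m} ↔ _
    rw [Submodule.mem_colon_singleton, ← neg_mem_iff, mem_iff_of_range_eq_idealToPi h]
    refine exists_congr fun x => ?_
    rw [LinearMap.mem_ker, Matrix.mulVecLin_apply, fromCols_const_mulVec, funext_iff,
      Unique.forall_iff, eq_neg_iff_add_eq_zero, smul_eq_mul, mul_comm]
    rfl

theorem HasLinearResolution.sup_span_singleton {d : ℕ} {I : Ideal (MvPolynomial σ R)}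
    {m : MvPolynomial σ R} (hI : HasLinearResolution d I) (hm : m.IsHomogeneous d)
    (hcolon : HasLinearResolution 1 (I.colon {m})) :
    HasLinearResolution d (I ⊔ Ideal.span {m}) := by
  obtain ⟨k, hI⟩ := hI
  obtain ⟨l, hcolon⟩ := hcolon
  obtain ⟨κ, _, D, hD, hrange, hker⟩ := (hI.mono (le_max_left k l)).succ
  refine ⟨max k l + 1, κ ⊕ Unit, inferInstance, Matrix.fromCols D (Matrix.of fun _ _ => m), ?_,
    range_fromCols_const hrange m,
    .of_isGradedExtension hker (hcolon.mono (le_max_right k l))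
      (isGradedExtension_ker_fromCols_const hD hm hrange)⟩
  rintro i (j | _)
  exacts [hD i j, hm]

theorem colon_span_X_image {V : Set σ} {x : σ} (hx : x ∉ V) :
    (Ideal.span (X '' V : Set (MvPolynomial σ R))).colon {X x} = Ideal.span (X '' V) := by
  classical
  refine le_antisymm (fun c hc => ?_) fun c hc =>
    Submodule.mem_colon_singleton.2 (Ideal.mul_mem_right (X x) _ hc)
  rw [Submodule.mem_colon_singleton, smul_eq_mul, mem_ideal_span_X_image] at hc
  refine mem_ideal_span_X_image.2 fun u hu => ?_
  obtain ⟨i, hi, hne⟩ := hc (u + Finsupp.single x 1) (by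
    rwa [mem_support_iff, coeff_mul_X, ← mem_support_iff])
  have hxi : x ≠ i := by rintro rfl; exact hx hi
  exact ⟨i, hi, by simpa [Finsupp.single_apply, hxi] using hne⟩

theorem hasLinearResolution_span_X_image {V : Set σ} (hV : V.Finite) :
    HasLinearResolution 1 (Ideal.span (X '' V : Set (MvPolynomial σ R))) := by
  induction V, hV using Set.Finite.induction_on with
  | empty => simpa using HasLinearResolution.bot (σ := σ) (R := R) 1
  | @insert x V hx _ ih =>
    rw [Set.image_insert_eq, Ideal.span_insert, sup_comm]
    exact ih.sup_span_singleton (isHomogeneous_X R x) (by rwa [colon_span_X_image hx])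

theorem HasLinearResolution.hasLinearFreeResolution {K : Type*} [Field K] {d : ℕ}
    {I : Ideal (MvPolynomial σ K)} (h : HasLinearResolution d I) : HasLinearFreeResolution I := by
  obtain ⟨k, h⟩ := h
  obtain ⟨κ, _, D₀, D, hD₀, hD, hrange, hexact, hexacts⟩ := h.exists_exact_sequence
  have hlin : ⇑(Fintype.linearCombination (MvPolynomial σ K) (D₀ ())) =
      fun y => D₀.mulVec y () := by
    ext1 y
    simp [Fintype.linearCombination_apply, Matrix.mulVec, dotProduct, mul_comm]
  refine ⟨d, ⟨{
    ι := κ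
    finite_rank := inferInstance
    gen := D₀ ()
    diff := D
    gen_isHomogeneous := hD₀ ()
    diff_isHomogeneous := hD
    span_gen := ?_
    exact_zero := ?_
    exact_succ := hexacts }⟩⟩
  · ext p
    rw [mem_iff_of_range_eq_idealToPi hrange, Ideal.span, ← Fintype.range_linearCombination,
      LinearMap.mem_range, hlin]
  · intro y
    rw [hlin, ← hexact y, Matrix.mulVecLin_apply, funext_iff, Unique.forall_iff]
    rfl

end LinearResolutions

section LinearQuotients

variable {σ R : Type*} [CommRing R]

variable (R) in
/-- The ideal generated by the monomials with exponents in `G`. -/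
noncomputable def monomialSpan (G : Set (σ →₀ ℕ)) : Ideal (MvPolynomial σ R) :=
  Ideal.span ((fun a => monomial a 1) '' G)

open Pointwise in
theorem monomialSpan_mul (P Q : Set (σ →₀ ℕ)) :
    monomialSpan R P * monomialSpan R Q = monomialSpan R (P + Q) := by
  rw [monomialSpan, monomialSpan, monomialSpan, Ideal.span_mul_span', ← Set.image2_mul,
    ← Set.image2_add, Set.image2_image_left, Set.image2_image_right, Set.image_image2]
  simp only [monomial_mul, mul_one]

theorem monomialSpan_insert (m : σ →₀ ℕ) (G : Set (σ →₀ ℕ)) :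
    monomialSpan R (insert m G) = monomialSpan R G ⊔ Ideal.span {monomial m 1} := by
  rw [monomialSpan, Set.image_insert_eq, Ideal.span_insert, sup_comm, monomialSpan]

theorem monomial_mul_mem_monomialSpan {G : Set (σ →₀ ℕ)} {m : σ →₀ ℕ} {c : MvPolynomial σ R} :
    c * monomial m 1 ∈ monomialSpan R G ↔ ∀ u ∈ c.support, ∃ γ ∈ G, γ ≤ u + m := by
  classical
  rw [monomialSpan, mem_ideal_span_monomial_image]
  constructor
  · intro h u hu
    refine h _ ?_
    rwa [mem_support_iff, coeff_mul_monomial, mul_one, ← mem_support_iff]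
  · intro h w hw
    rw [mem_support_iff, coeff_mul_monomial', mul_one, ite_ne_right_iff] at hw
    obtain ⟨γ, hγ, hle⟩ := h _ (mem_support_iff.2 hw.2)
    exact ⟨γ, hγ, by rwa [tsub_add_cancel_of_le hw.1] at hle⟩

theorem monomialSpan_colon_monomial {G : Set (σ →₀ ℕ)} {m : σ →₀ ℕ}
    (h : ∀ β ∈ G, ∃ v, m v < β v ∧ ∃ γ ∈ G, γ ≤ m + Finsupp.single v 1) :
    (monomialSpan R G).colon {monomial m 1} =
      Ideal.span (X '' {v | ∃ γ ∈ G, γ ≤ m + Finsupp.single v 1}) := by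
  ext c
  rw [Submodule.mem_colon_singleton, smul_eq_mul, monomial_mul_mem_monomialSpan,
    mem_ideal_span_X_image]
  refine forall₂_congr fun u _ => ⟨?_, ?_⟩
  · rintro ⟨β, hβ, hle⟩
    obtain ⟨v, hv, hγ⟩ := h β hβ
    have := hv.trans_le (hle v)
    rw [Finsupp.add_apply] at this
    exact ⟨v, hγ, by omega⟩
  · rintro ⟨v, ⟨γ, hγ, hle⟩, huv⟩
    refine ⟨γ, hγ, hle.trans ?_⟩
    rw [add_comm]
    gcongr
    rwa [Finsupp.single_le_iff, Nat.one_le_iff_ne_zero]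

theorem hasLinearResolution_monomialSpan_of_linearQuotients [Finite σ] {ι : Type*} [LinearOrder ι]
    {e : ι → σ →₀ ℕ} {F : Finset ι} {d : ℕ} (hd : ∀ i ∈ F, (e i).degree = d)
    (h : ∀ j ∈ F, ∀ i ∈ F, j < i →
      ∃ v, e j v < e i v ∧ ∃ k ∈ F, j < k ∧ e k ≤ e j + Finsupp.single v 1) :
    HasLinearResolution d (monomialSpan R (e '' F)) := by
  induction F using Finset.induction_on_min with
  | empty => simpa [monomialSpan] using HasLinearResolution.bot (σ := σ) (R := R) d
  | insert a F ha ih =>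
    rw [Finset.forall_mem_insert] at hd
    have hcolon : ∀ β ∈ e '' F, ∃ v, e a v < β v ∧ ∃ γ ∈ e '' F, γ ≤ e a + Finsupp.single v 1 := by
      rintro _ ⟨i, hi, rfl⟩
      obtain ⟨v, hv, k, hk, hak, hle⟩ :=
        h a (F.mem_insert_self a) i (Finset.mem_insert_of_mem hi) (ha i hi)
      exact ⟨v, hv, e k, ⟨k, Finset.mem_of_mem_insert_of_ne hk hak.ne', rfl⟩, hle⟩
    have hF : HasLinearResolution d (monomialSpan R (e '' F)) := by
      refine ih hd.2 fun j hj i hi hji => ?_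
      obtain ⟨v, hv, k, hk, hjk, hle⟩ :=
        h j (Finset.mem_insert_of_mem hj) i (Finset.mem_insert_of_mem hi) hji
      have hak := (ha j hj).trans hjk
      exact ⟨v, hv, k, Finset.mem_of_mem_insert_of_ne hk hak.ne', hjk, hle⟩
    rw [Finset.coe_insert, Set.image_insert_eq, monomialSpan_insert]
    refine hF.sup_span_singleton (isHomogeneous_monomial 1 hd.1) ?_
    rw [monomialSpan_colon_monomial hcolon]
    exact hasLinearResolution_span_X_image (Set.toFinite _)

/-- Weakly polymatroidal sets of exponents in the sense of Hibi and Kokubo, for the ordering of the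
variables in which the smaller indices come first. -/
def IsWeaklyPolymatroidal [LinearOrder σ] (G : Set (σ →₀ ℕ)) : Prop :=
  ∀ α ∈ G, ∀ β ∈ G, ∀ v, (∀ w < v, α w = β w) → α v < β v →
    ∃ k > v, 0 < α k ∧ α + Finsupp.single v 1 - Finsupp.single k 1 ∈ G

theorem IsWeaklyPolymatroidal.hasLinearResolution [Finite σ] [LinearOrder σ] {G : Set (σ →₀ ℕ)}
    (hG : IsWeaklyPolymatroidal G) {d : ℕ} (hd : ∀ α ∈ G, α.degree = d) :
    HasLinearResolution d (monomialSpan R G) := by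
  have hfin : G.Finite := (Finsupp.finite_of_degree_eq d).subset hd
  have hlex : (ofLex ⁻¹' G : Set (Lex (σ →₀ ℕ))).Finite := hfin.preimage ofLex.injective.injOn
  have hmem : ∀ α : Lex (σ →₀ ℕ), α ∈ hlex.toFinset ↔ ofLex α ∈ G := fun _ => hlex.mem_toFinset
  rw [← Set.image_preimage_eq G ofLex.surjective, ← hlex.coe_toFinset]
  refine hasLinearResolution_monomialSpan_of_linearQuotients
    (fun α hα => hd _ ((hmem α).1 hα)) fun α hα β hβ hlt => ?_
  obtain ⟨v, heq, hv⟩ := Finsupp.Lex.lt_iff.1 hlt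
  obtain ⟨k, hvk, -, hγ⟩ := hG _ ((hmem α).1 hα) _ ((hmem β).1 hβ) v heq hv
  refine ⟨v, hv, toLex _, (hmem _).2 hγ, Finsupp.Lex.lt_iff.2 ⟨v, fun w hw => ?_, ?_⟩, tsub_le_self⟩
  · simp [hw.ne', (hw.trans hvk).ne']
  · simp [hvk.ne']

end LinearQuotients

section CycleWeights

/-- The numerical data of a product of `N` generators `f_i` of `I_n` and `u` of the variables
`x_1`, `x_n`.  Each `f_i` is the complement of an edge of the `n`-cycle on the variables: `a v`, for
`0 < v < n`, counts the factors complementary to the edge `{v - 1, v}`, and `e` those complementary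
to the edge `{n - 1, 0}`, i.e. the factors `f_2`.  At the ends, `e - a 0` and `e - a n` count the
factors `x_1` and `x_n`, so that in all cases the exponent of the variable with index `v` is
`N - a v - a (v + 1)`.  At most `t` factors `f_2` are allowed. -/
structure IsCycleWeight (n t u : ℕ) (e : ℤ) (a : ℕ → ℤ) : Prop where
  nonneg : ∀ v, 0 < v → v < n → 0 ≤ a v
  closing_nonneg : 0 ≤ e
  closing_le : e ≤ t
  zero_le : a 0 ≤ e
  last_le : a n ≤ e
  ends_add : a 0 + a n + u = 2 * e

/-- The exponent at `w` of the monomial of a weight `a` can be raised by one at the expense of the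
exponent at some later `k`. -/
def CanRaise (n t u : ℕ) (a : ℕ → ℤ) (w : ℕ) : Prop :=
  ∃ k, w < k ∧ k < n ∧ ∃ e c, IsCycleWeight n t u e c ∧
    ∀ v < n, c v + c (v + 1) =
      a v + a (v + 1) - (if v = w then 1 else 0) + (if v = k then 1 else 0)

/-- The alternating vector on `{0, …, w}` ending in `-1`. Adding it to a weight raises the exponent
at `w` by one and changes no other. -/
def zigzag (w v : ℕ) : ℤ :=
  if v ≤ w then -(-1) ^ (w + v) else 0

theorem zigzag_of_lt {w v : ℕ} (h : w < v) : zigzag w v = 0 :=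
  if_neg h.not_ge

theorem zigzag_add_zigzag_succ (w v : ℕ) :
    zigzag w v + zigzag w (v + 1) = -(if v = w then 1 else 0) := by
  rcases lt_trichotomy v w with h | rfl | h
  · rw [zigzag, zigzag, if_pos h.le, if_pos (Nat.succ_le_of_lt h), if_neg h.ne]
    ring
  · rw [zigzag_of_lt v.lt_succ_self, zigzag, if_pos le_rfl, if_pos rfl, ← two_mul]
    simp
  · rw [zigzag_of_lt h, zigzag_of_lt (h.trans v.lt_succ_self), if_neg h.ne']
    simp

theorem zigzag_eq_one_or_eq_neg_one {w v : ℕ} (h : v ≤ w) : zigzag w v = 1 ∨ zigzag w v = -1 := by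
  rw [zigzag, if_pos h]
  rcases neg_one_pow_eq_or ℤ (w + v) with h | h <;> simp [h]

theorem eq_neg_zigzag_mul_of_alternating {d : ℕ → ℤ} {w v : ℕ} (hvw : v ≤ w)
    (h : ∀ i < w, d i + d (i + 1) = 0) : d v = -zigzag w v * d w := by
  rw [zigzag, if_pos hvw, neg_neg]
  induction w, hvw using Nat.le_induction with
  | base => simp [← two_mul]
  | succ w _ ih =>
    rw [ih fun i hi => h i (hi.trans w.lt_succ_self),
      eq_neg_of_add_eq_zero_left (h w w.lt_succ_self)]
    ring

theorem eq_neg_zigzag_mul_sub {a b : ℕ → ℤ} {w v : ℕ}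
    (heq : ∀ v < w, a v + a (v + 1) = b v + b (v + 1)) (hvw : v ≤ w) :
    b v - a v = -zigzag w v * (b w - a w) :=
  eq_neg_zigzag_mul_of_alternating (d := fun v => b v - a v) hvw fun i hi => by
    linear_combination -(heq i hi)

namespace IsCycleWeight

variable {n t u w : ℕ} {e e' : ℤ} {a b : ℕ → ℤ}

theorem canRaise_of_pos_succ (h : IsCycleWeight n t u e a) (hw : w + 2 < n) (ha : 0 < a (w + 1)) :
    CanRaise n t u a w := by
  refine ⟨w + 2, by omega, hw, e,
    fun v => a v + (if v = w + 2 then 1 else 0) - (if v = w + 1 then 1 else 0), ?_, ?_⟩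
  · have ⟨_, _, _, _, _, _⟩ := h
    constructor <;> grind
  · grind

theorem canRaise_of_lt_closing (h : IsCycleWeight n t u e a) (hw : w + 2 = n) (ha : 0 < a (w + 1))
    (het : e < t) (han : a n < e) : CanRaise n t u a w := by
  refine ⟨w + 1, by omega, by omega, e + 1,
    fun v => a v + 2 * (if v = n then 1 else 0) - (if v = w + 1 then 1 else 0), ?_, ?_⟩
  · have ⟨_, _, _, _, _, _⟩ := h
    constructor <;> grind
  · grind

theorem canRaise_zigzag_last (h : IsCycleWeight n t u e a) (hw : w + 1 < n)
    (hz : ∀ v, 0 < v → v ≤ w → 0 ≤ a v + zigzag w v)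
    (hend : zigzag w 0 = -1 ∧ a n < e ∨ zigzag w 0 = 1 ∧ e < t) : CanRaise n t u a w := by
  refine ⟨n - 1, by omega, by omega, if zigzag w 0 = 1 then e + 1 else e,
    fun v => a v + zigzag w v + (if v = n then 1 else 0), ?_, ?_⟩
  · have ⟨_, _, _, _, _, _⟩ := h
    constructor <;> grind [zigzag_of_lt]
  · grind [zigzag_add_zigzag_succ]

theorem canRaise_zigzag_second_last (h : IsCycleWeight n t u e a) (hw : w + 2 < n)
    (hz : ∀ v, 0 < v → v ≤ w → 0 ≤ a v + zigzag w v)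
    (hend : zigzag w 0 = -1 ∧ 0 < e ∨ zigzag w 0 = 1 ∧ a 0 < e) : CanRaise n t u a w := by
  refine ⟨n - 2, by omega, by omega, if zigzag w 0 = 1 then e else e - 1,
    fun v => a v + zigzag w v + (if v = n - 1 then 1 else 0) - (if v = n then 1 else 0), ?_, ?_⟩
  · have ⟨_, _, _, _, _, _⟩ := h
    constructor <;> grind [zigzag_of_lt]
  · grind [zigzag_add_zigzag_succ]

theorem add_zigzag_nonneg (ha : IsCycleWeight n t u e a) (hb : IsCycleWeight n t u e' b)
    (heq : ∀ v < w, a v + a (v + 1) = b v + b (v + 1)) (hwn : w < n) (hw : b w < a w) (v : ℕ)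
    (hv : 0 < v) (hvw : v ≤ w) : 0 ≤ a v + zigzag w v := by
  have hav := ha.nonneg v hv (hvw.trans_lt hwn)
  have hbv := hb.nonneg v hv (hvw.trans_lt hwn)
  have hd := eq_neg_zigzag_mul_sub heq hvw
  rcases zigzag_eq_one_or_eq_neg_one hvw with hz | hz <;> rw [hz] at hd ⊢ <;> omega

theorem canRaise_of_add_two_lt (ha : IsCycleWeight n t u e a) (hb : IsCycleWeight n t u e' b)
    (hwn : w + 2 < n) (heq : ∀ v < w, a v + a (v + 1) = b v + b (v + 1))
    (hw : b w + b (w + 1) < a w + a (w + 1)) : CanRaise n t u a w := by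
  by_cases hpos : 0 < a (w + 1)
  · exact ha.canRaise_of_pos_succ hwn hpos
  have hbpos := hb.nonneg (w + 1) w.succ_pos (by omega)
  have hz := ha.add_zigzag_nonneg hb heq (by omega) (by omega)
  have ⟨_, _, _, _, _, _⟩ := ha
  have ⟨_, _, _, _, _, _⟩ := hb
  have hd := eq_neg_zigzag_mul_sub heq w.zero_le
  rcases zigzag_eq_one_or_eq_neg_one w.zero_le with hs | hs <;> rw [hs] at hd
  · by_cases het : e < t
    · exact ha.canRaise_zigzag_last (by omega) hz (.inr ⟨hs, het⟩)
    · exact ha.canRaise_zigzag_second_last hwn hz (.inr ⟨hs, by omega⟩)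
  · by_cases hlast : a n < e
    · exact ha.canRaise_zigzag_last (by omega) hz (.inl ⟨hs, hlast⟩)
    · exact ha.canRaise_zigzag_second_last hwn hz (.inl ⟨hs, by omega⟩)

theorem canRaise_of_add_two_eq (ha : IsCycleWeight n t u e a) (hb : IsCycleWeight n t u e' b)
    (hwn : w + 2 = n) (heq : ∀ v < w, a v + a (v + 1) = b v + b (v + 1))
    (hw : b w + b (w + 1) < a w + a (w + 1)) (hlast : a (w + 1) + a n < b (w + 1) + b n) :
    CanRaise n t u a w := by
  have hbpos := hb.nonneg (w + 1) w.succ_pos (by omega)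
  have hz := ha.add_zigzag_nonneg hb heq (by omega)
  have ⟨_, _, _, _, _, _⟩ := ha
  have ⟨_, _, _, _, _, _⟩ := hb
  have hd := eq_neg_zigzag_mul_sub heq w.zero_le
  by_cases hlt : b w < a w
  · refine ha.canRaise_zigzag_last (by omega) (hz hlt) ?_
    rcases zigzag_eq_one_or_eq_neg_one w.zero_le with hs | hs <;> rw [hs] at hd <;> omega
  · have hends : e < t ∧ a n < e := by
      rcases zigzag_eq_one_or_eq_neg_one w.zero_le with hs | hs <;> rw [hs] at hd <;> omega
    exact ha.canRaise_of_lt_closing hwn (by omega) hends.1 hends.2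

theorem canRaise (ha : IsCycleWeight n t u e a) (hb : IsCycleWeight n t u e' b)
    (heq : ∀ v < w, a v + a (v + 1) = b v + b (v + 1))
    (hw : b w + b (w + 1) < a w + a (w + 1))
    (hk : ∃ k, w < k ∧ k < n ∧ a k + a (k + 1) < b k + b (k + 1)) : CanRaise n t u a w := by
  obtain ⟨k, hwk, hkn, hk⟩ := hk
  obtain hwn | rfl : w + 2 < n ∨ n = w + 2 := by omega
  · exact ha.canRaise_of_add_two_lt hb hwn heq hw
  · obtain rfl : k = w + 1 := by omega
    exact ha.canRaise_of_add_two_eq hb rfl heq hw hk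

end IsCycleWeight

end CycleWeights

section CycleExponents

open Finset

/-- The exponents of the products of `N` generators of `I_n`, at most `t` of which are `f_2`, and
`u` of the variables `x_1`, `x_n`. -/
def cycleExponents (n N t u : ℕ) : Set (Fin n →₀ ℕ) :=
  {α | ∃ e a, IsCycleWeight n t u e a ∧ e + ∑ v ∈ Ico 1 n, a v = N ∧
    ∀ v : Fin n, (α v : ℤ) + a v + a (v + 1) = N}

theorem sum_range_add_succ (a : ℕ → ℤ) {n : ℕ} (hn : 1 ≤ n) :
    ∑ v ∈ range n, (a v + a (v + 1)) = 2 * ∑ v ∈ Ico 1 n, a v + a 0 + a n := by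
  induction n, hn using Nat.le_induction with
  | base => simp
  | succ n hn ih => rw [sum_range_succ, ih, sum_Ico_succ_top hn]; ring

namespace IsCycleWeight

variable {n t u : ℕ} {e : ℤ} {a : ℕ → ℤ}

theorem sum_range_add (h : IsCycleWeight n t u e a) (hn : 1 ≤ n) :
    ∑ v ∈ range n, (a v + a (v + 1)) + u = 2 * (e + ∑ v ∈ Ico 1 n, a v) := by
  rw [sum_range_add_succ a hn]
  linear_combination h.ends_add

theorem add_succ_le (h : IsCycleWeight n t u e a) (hn : 2 ≤ n) {v : ℕ} (hv : v < n) :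
    a v + a (v + 1) ≤ e + ∑ i ∈ Ico 1 n, a i := by
  have hnonneg : ∀ i ∈ Ico 1 n, 0 ≤ a i := fun i hi => by
    rw [mem_Ico] at hi
    exact h.nonneg i hi.1 hi.2
  have hzero := h.zero_le
  have hlast := h.last_le
  have hclosing := h.closing_nonneg
  rcases Nat.eq_zero_or_pos v with rfl | hpos
  · have := single_le_sum hnonneg (mem_Ico.2 ⟨le_rfl, (by omega : 1 < n)⟩)
    rw [zero_add]
    omega
  · obtain hvn | rfl : v + 1 < n ∨ n = v + 1 := by omega
    · have := add_le_sum hnonneg (mem_Ico.2 ⟨hpos, hv⟩) (mem_Ico.2 ⟨Nat.le_add_left 1 v, hvn⟩)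
        (by omega)
      omega
    · have := single_le_sum hnonneg (mem_Ico.2 ⟨hpos, hv⟩)
      omega

end IsCycleWeight

theorem degree_of_mem_cycleExponents {n N t u : ℕ} (hn : 2 ≤ n) {α : Fin n →₀ ℕ}
    (hα : α ∈ cycleExponents n N t u) : α.degree = (n - 2) * N + u := by
  obtain ⟨e, a, ha, hN, hval⟩ := hα
  have hsum : (∑ v, (α v : ℤ)) + ∑ v ∈ range n, (a v + a (v + 1)) = n * N := by
    rw [← Fin.sum_univ_eq_sum_range fun v => a v + a (v + 1), ← sum_add_distrib,
      sum_congr rfl fun v _ => (add_assoc _ _ _).symm.trans (hval v)]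
    simp
  have hpairs := ha.sum_range_add (by omega)
  rw [hN] at hpairs
  rw [Finsupp.degree_eq_sum]
  zify [hn]
  linear_combination hsum - hpairs

theorem exists_gt_of_degree_eq {σ : Type*} [Finite σ] [LinearOrder σ] {α β : σ →₀ ℕ} {w : σ}
    (hdeg : α.degree = β.degree) (heq : ∀ v < w, α v = β v) (hw : α w < β w) :
    ∃ k > w, β k < α k := by
  by_contra! hle
  have := Fintype.ofFinite σ
  refine (sum_lt_sum (fun v _ => ?_) ⟨w, mem_univ w, hw⟩).ne
    (by rwa [← Finsupp.degree_eq_sum, ← Finsupp.degree_eq_sum])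
  rcases lt_trichotomy v w with h | rfl | h
  exacts [(heq v h).le, hw.le, hle v h]

theorem CanRaise.exists_mem_cycleExponents {n N t u : ℕ} (hn : 2 ≤ n) {e : ℤ} {a : ℕ → ℤ}
    (ha : IsCycleWeight n t u e a) (hN : e + ∑ v ∈ Ico 1 n, a v = N) {α : Fin n →₀ ℕ}
    (hα : ∀ v : Fin n, (α v : ℤ) + a v + a (v + 1) = N) {w : Fin n} (h : CanRaise n t u a w) :
    ∃ k > w, 0 < α k ∧
      α + Finsupp.single w 1 - Finsupp.single k 1 ∈ cycleExponents n N t u := by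
  obtain ⟨k, hwk, hkn, e', c, hc, hpairs⟩ := h
  have hNc : e' + ∑ v ∈ Ico 1 n, c v = N := by
    have hac := sum_congr rfl fun v hv => hpairs v (mem_range.1 hv)
    simp only [sum_add_distrib (g := fun v => if v = k then (1 : ℤ) else 0), sum_sub_distrib,
      sum_ite_eq', mem_range, w.isLt, hkn, if_true] at hac
    linarith [ha.sum_range_add (by omega), hc.sum_range_add (by omega)]
  have hαk : 0 < α ⟨k, hkn⟩ := by
    have hle := hc.add_succ_le hn hkn
    have hval := hα ⟨k, hkn⟩
    grind
  refine ⟨⟨k, hkn⟩, hwk, hαk, e', c, hc, hNc, fun v => ?_⟩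
  have hpair := hpairs v v.isLt
  have hval := hα v
  simp only [Finsupp.tsub_apply, Finsupp.add_apply, Finsupp.single_apply, Fin.ext_iff]
  grind

theorem isWeaklyPolymatroidal_cycleExponents {n : ℕ} (hn : 2 ≤ n) (N t u : ℕ) :
    IsWeaklyPolymatroidal (cycleExponents n N t u) := by
  intro α hα β hβ w heq hw
  obtain ⟨k, hwk, hk⟩ := exists_gt_of_degree_eq ((degree_of_mem_cycleExponents hn hα).trans
    (degree_of_mem_cycleExponents hn hβ).symm) heq hw
  obtain ⟨e, a, ha, hN, hαa⟩ := hα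
  obtain ⟨e', b, hb, -, hβb⟩ := hβ
  refine CanRaise.exists_mem_cycleExponents hn ha hN hαa
    (ha.canRaise hb (fun v hv => ?_) ?_ ⟨k, hwk, k.isLt, ?_⟩)
  · have hlt : v < n := hv.trans w.isLt
    linarith [hαa ⟨v, hlt⟩, hβb ⟨v, hlt⟩, congrArg (Nat.cast (R := ℤ)) (heq ⟨v, hlt⟩ hv)]
  · linarith [hαa w, hβb w, Nat.cast_lt (α := ℤ).2 hw]
  · linarith [hαa k, hβb k, Nat.cast_lt (α := ℤ).2 hk]

end CycleExponents

section PathIdeals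

open Finset Pointwise

/-- The exponent of `pathMonomial K n i`. -/
noncomputable def pathExponent (n : ℕ) (i : Fin n) : Fin n →₀ ℕ :=
  ∑ k ∈ range (n - 2), Finsupp.single ⟨(i.val + k) % n, Nat.mod_lt _ i.pos⟩ 1

theorem pathMonomial_eq_monomial (K : Type*) [Field K] (n : ℕ) (i : Fin n) :
    pathMonomial K n i = monomial (pathExponent n i) 1 := by
  rw [pathExponent, monomial_sum_one]
  rfl

/-- The change of a cycle weight when a factor `pathMonomial K n i` is added: the indicator of the
edge `{v - 1, v}` of the `n`-cycle complementary to it, where the edge `{n - 1, 0}` is counted both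
at `v = 0` and at `v = n`. -/
def complementaryEdge {n : ℕ} (i : Fin n) (v : ℕ) : ℤ :=
  if (v + 1) % n = i then 1 else 0

theorem complementaryEdge_self {n : ℕ} (i : Fin n) :
    complementaryEdge i n = complementaryEdge i 0 := by
  simp [complementaryEdge]

theorem sum_range_shift_mod {M : Type*} [AddCommMonoid M] (n : ℕ) (g : ℕ → M) :
    ∑ v ∈ range n, g ((v + 1) % n) = ∑ v ∈ range n, g v := by
  cases n with
  | zero => rfl
  | succ n =>
    rw [sum_range_succ, sum_range_succ', Nat.mod_self]
    refine congrArg (· + g 0) (sum_congr rfl fun v hv => ?_)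
    rw [Nat.mod_eq_of_lt (Nat.succ_lt_succ (mem_range.1 hv))]

theorem complementaryEdge_sum {n : ℕ} (i : Fin n) :
    complementaryEdge i 0 + ∑ v ∈ Ico 1 n, complementaryEdge i v = 1 := by
  rw [← sum_eq_sum_Ico_succ_bot i.pos (complementaryEdge i), ← range_eq_Ico]
  refine (sum_range_shift_mod n fun x => if x = i then (1 : ℤ) else 0).trans ?_
  rw [sum_ite_eq', if_pos (mem_range.2 i.isLt)]

theorem add_mul_complementaryEdge_sum {n N : ℕ} {e r : ℤ} {a : ℕ → ℤ} (i : Fin n)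
    (hN : e + ∑ v ∈ Ico 1 n, a v = N) :
    e + r * complementaryEdge i 0 + ∑ v ∈ Ico 1 n, (a v + r * complementaryEdge i v) = N + r := by
  rw [sum_add_distrib, ← mul_sum]
  linear_combination hN + r * complementaryEdge_sum i

theorem add_mod_eq_iff {n k r i v : ℕ} (hkr : k + r = n) (hi : i < n) (hv : v < n) :
    (i + k) % n = v ↔ (v + r) % n = i := by
  have hmod : ∀ x < 2 * n, x % n = if x < n then x else x - n := by
    intro x hx
    split_ifs with h
    · exact Nat.mod_eq_of_lt h
    · rw [Nat.mod_eq_sub_mod (not_lt.1 h), Nat.mod_eq_of_lt (by omega)]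
  rw [hmod _ (by omega), hmod _ (by omega)]
  split_ifs <;> omega

theorem pathExponent_add_complementaryEdge {n : ℕ} (hn : 2 ≤ n) (i v : Fin n) :
    (pathExponent n i v : ℤ) + complementaryEdge i v + complementaryEdge i (v + 1) = 1 := by
  obtain ⟨m, rfl⟩ := Nat.exists_eq_add_of_le' hn
  have hall : ∑ k ∈ range (m + 2),
      (if (i.val + k) % (m + 2) = v.val then (1 : ℤ) else 0) = 1 := by
    rw [← Fin.sum_univ_eq_sum_range
      fun k => if (i.val + k) % (m + 2) = v.val then (1 : ℤ) else 0]
    calc ∑ k : Fin (m + 2), (if (i.val + k) % (m + 2) = v.val then (1 : ℤ) else 0)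
        = ∑ k, if i + k = v then 1 else 0 := by simp only [Fin.ext_iff, Fin.val_add]
      _ = ∑ k, if k = v then 1 else 0 :=
        Equiv.sum_comp (Equiv.addLeft i) fun k => if k = v then (1 : ℤ) else 0
      _ = 1 := by rw [sum_ite_eq' univ v, if_pos (mem_univ v)]
  rw [sum_range_succ, sum_range_succ] at hall
  simp only [add_mod_eq_iff (k := m) (r := 2) rfl i.isLt v.isLt,
    add_mod_eq_iff (k := m + 1) (r := 1) rfl i.isLt v.isLt] at hall
  simp only [complementaryEdge, pathExponent, add_tsub_cancel_right, Finsupp.finsetSum_apply,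
    Finsupp.single_apply, Fin.ext_iff, add_assoc, Nat.reduceAdd]
  push_cast
  linarith

theorem IsCycleWeight.add_mul_complementaryEdge {n t t' u : ℕ} {e : ℤ} {a : ℕ → ℤ}
    (h : IsCycleWeight n t u e a) (i : Fin n) {r : ℤ}
    (hnonneg : ∀ v, 0 < v → v < n → 0 ≤ a v + r * complementaryEdge i v)
    (hclosing : 0 ≤ e + r * complementaryEdge i 0) (hle : e + r * complementaryEdge i 0 ≤ t') :
    IsCycleWeight n t' u (e + r * complementaryEdge i 0)
      fun v => a v + r * complementaryEdge i v where
  nonneg := hnonneg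
  closing_nonneg := hclosing
  closing_le := hle
  zero_le := add_le_add_left h.zero_le _
  last_le := by
    rw [complementaryEdge_self]
    exact add_le_add_left h.last_le _
  ends_add := by
    rw [complementaryEdge_self]
    linear_combination h.ends_add

theorem exists_add_eq_of_isCycleWeight {n N t u : ℕ} (hn : 2 ≤ n) {e : ℤ} {a : ℕ → ℤ}
    (h : IsCycleWeight n t u e a) (hN : e + ∑ v ∈ Ico 1 n, a v = N) {α g : Fin n →₀ ℕ}
    (hα : ∀ v : Fin n, (α v : ℤ) + a v + a (v + 1) = N + g v) :
    ∃ β ∈ cycleExponents n N t u, β + g = α := by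
  have hle : ∀ v, g v ≤ α v := fun v => by
    have := h.add_succ_le hn v.isLt
    have := hα v
    omega
  refine ⟨α - g, ⟨e, a, h, hN, fun v => ?_⟩, tsub_add_cancel_of_le hle⟩
  rw [Finsupp.tsub_apply, Nat.cast_sub (hle v)]
  linear_combination hα v

theorem add_pathExponent_mem_cycleExponents {n N t t' u : ℕ} (hn : 2 ≤ n) {α : Fin n →₀ ℕ}
    (hα : α ∈ cycleExponents n N t u) {i : Fin n}
    (ht : t + complementaryEdge i 0 ≤ t') :
    α + pathExponent n i ∈ cycleExponents n (N + 1) t' u := by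
  obtain ⟨e, a, ha, hN, hval⟩ := hα
  have hedge : ∀ v, 0 ≤ complementaryEdge i v := fun v => by
    rw [complementaryEdge]
    positivity
  have hclosing := ha.closing_nonneg
  have hle := ha.closing_le
  refine ⟨_, _, ha.add_mul_complementaryEdge (t' := t') i (r := 1)
    (fun v hv hvn => ?_) ?_ ?_, ?_, fun v => ?_⟩
  · linarith [ha.nonneg v hv hvn, hedge v]
  · linarith [hedge 0]
  · linarith
  · exact mod_cast add_mul_complementaryEdge_sum i hN
  · rw [Finsupp.add_apply]
    push_cast
    linear_combination hval v + pathExponent_add_complementaryEdge hn i v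

theorem IsCycleWeight.exists_complementaryEdge_le {n t u : ℕ} (hn : 2 ≤ n) {e : ℤ} {a : ℕ → ℤ}
    (h : IsCycleWeight n t u e a) (hpos : 0 < e + ∑ v ∈ Ico 1 n, a v) :
    ∃ i : Fin n, (i.val = 1 → 0 < t) ∧
      (∀ v, 0 < v → v < n → complementaryEdge i v ≤ a v) ∧
      complementaryEdge i 0 ≤ e ∧ e - complementaryEdge i 0 ≤ (t - 1 : ℕ) := by
  have hclosing := h.closing_nonneg
  have hle := h.closing_le
  have hinj : ∀ v < n, ∀ w < n, (v + 1) % n = (w + 1) % n → v = w := fun v hv w hw h =>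
    Nat.ModEq.eq_of_lt_of_lt (Nat.ModEq.add_right_cancel' 1 h) hv hw
  simp only [complementaryEdge]
  rcases hclosing.eq_or_lt with rfl | he
  · obtain ⟨w, hw, hwpos⟩ : ∃ w ∈ Ico 1 n, 0 < a w := by
      by_contra! hnonpos
      linarith [sum_nonpos hnonpos]
    rw [mem_Ico] at hw
    have hone : (0 + 1) % n ≠ (w + 1) % n := fun h => by
      have := hinj 0 (by omega) w hw.2 h
      omega
    refine ⟨⟨(w + 1) % n, Nat.mod_lt _ (by omega)⟩, fun h => ?_, fun v hv hvn => ?_, ?_⟩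
    · exact absurd (h.trans (Nat.mod_eq_of_lt hn).symm).symm hone
    · split_ifs with hvw
      · rw [hinj v hvn w hw.2 hvw]
        exact hwpos
      · exact h.nonneg v hv hvn
    · rw [if_neg hone, sub_zero]
      exact ⟨le_rfl, Nat.cast_nonneg _⟩
  · refine ⟨⟨1, hn⟩, fun _ => by omega, fun v hv hvn => ?_, ?_⟩
    · rw [if_neg fun h => ?_]
      · exact h.nonneg v hv hvn
      · have := hinj v hvn 0 (by omega) (h.trans (Nat.mod_eq_of_lt hn).symm)
        omega
    · rw [zero_add, Nat.mod_eq_of_lt hn, if_pos rfl]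
      omega

theorem exists_add_pathExponent_eq {n N t u : ℕ} (hn : 2 ≤ n) {α : Fin n →₀ ℕ}
    (hα : α ∈ cycleExponents n (N + 1) t u) :
    ∃ i : Fin n, (i.val = 1 → 0 < t) ∧
      ∃ β ∈ cycleExponents n N (t - 1) u, β + pathExponent n i = α := by
  obtain ⟨e, a, ha, hN, hval⟩ := hα
  obtain ⟨i, hi, hnonneg, hclosing, ht⟩ :=
    ha.exists_complementaryEdge_le hn (by rw [hN]; positivity)
  have hweight := ha.add_mul_complementaryEdge (t' := t - 1) i (r := -1)
    (fun v hv hvn => by linarith [hnonneg v hv hvn]) (by linarith) (by linarith)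
  refine ⟨i, hi, exists_add_eq_of_isCycleWeight hn hweight ?_ fun v => ?_⟩
  · rw [add_mul_complementaryEdge_sum i hN]
    simp
  · have hv := hval v
    push_cast at hv
    linear_combination hv - pathExponent_add_complementaryEdge hn i v

theorem cycleExponents_add_range_pathExponent {n : ℕ} (hn : 2 ≤ n) (N t u : ℕ) :
    cycleExponents n N t u + Set.range (pathExponent n) = cycleExponents n (N + 1) (t + 1) u := by
  refine Set.Subset.antisymm (Set.add_subset_iff.2 ?_) fun α hα => ?_
  · rintro α hα _ ⟨i, rfl⟩
    refine add_pathExponent_mem_cycleExponents hn hα ?_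
    rw [complementaryEdge]
    split_ifs <;> simp
  · obtain ⟨i, -, β, hβ, rfl⟩ := exists_add_pathExponent_eq hn hα
    exact Set.add_mem_add hβ ⟨i, rfl⟩

theorem cycleExponents_zero_add_image_pathExponent {n : ℕ} (hn : 2 ≤ n) (N u : ℕ) :
    cycleExponents n N 0 u + pathExponent n '' {i | i.val ≠ 1} = cycleExponents n (N + 1) 0 u := by
  refine Set.Subset.antisymm (Set.add_subset_iff.2 ?_) fun α hα => ?_
  · rintro α hα _ ⟨i, hi, rfl⟩
    refine add_pathExponent_mem_cycleExponents hn hα ?_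
    rw [complementaryEdge, zero_add, Nat.mod_eq_of_lt hn, if_neg (Ne.symm hi), add_zero]
  · obtain ⟨i, hi, β, hβ, rfl⟩ := exists_add_pathExponent_eq hn hα
    exact Set.add_mem_add hβ ⟨i, fun h => (hi h).ne rfl, rfl⟩

theorem cycleExponents_zero_zero_zero {n : ℕ} (hn : 2 ≤ n) : cycleExponents n 0 0 0 = {0} := by
  refine Set.Subset.antisymm (fun α hα => ?_) (Set.singleton_subset_iff.2 ?_)
  · exact (Finsupp.degree_eq_zero_iff α).1 (by simpa using degree_of_mem_cycleExponents hn hα)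
  · exact ⟨0, 0, ⟨fun _ _ _ => le_rfl, le_rfl, le_rfl, le_rfl, le_rfl, rfl⟩, by simp, by simp⟩

/-- The exponent of `x_1` if `w = 0` and of `x_n` if `w = n`, written as the effect on exponents of
lowering a cycle weight by one at `w`. -/
noncomputable def endExponent (n w : ℕ) : Fin n →₀ ℕ :=
  Finsupp.equivFunOnFinite.symm fun v =>
    (if v.val = w then 1 else 0) + if v.val + 1 = w then 1 else 0

theorem endExponent_zero {n : ℕ} (hn : 0 < n) : endExponent n 0 = Finsupp.single ⟨0, hn⟩ 1 := by
  ext v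
  simp only [endExponent, Finsupp.equivFunOnFinite_symm_apply_apply, Finsupp.single_apply,
    Fin.ext_iff]
  grind

theorem endExponent_self {n : ℕ} (hn : 0 < n) :
    endExponent n n = Finsupp.single ⟨n - 1, by omega⟩ 1 := by
  ext v
  simp only [endExponent, Finsupp.equivFunOnFinite_symm_apply_apply, Finsupp.single_apply,
    Fin.ext_iff]
  grind

theorem IsCycleWeight.add_ite_end {n t u u' : ℕ} (hn : 0 < n) {e r : ℤ} {a : ℕ → ℤ}
    (h : IsCycleWeight n t u e a) {w : ℕ} (hw : w = 0 ∨ w = n) (hr : a w + r ≤ e)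
    (hu : u' + r = u) :
    IsCycleWeight n t u' e fun v => a v + if v = w then r else 0 where
  nonneg v hv hvn := by
    rw [if_neg (by omega), add_zero]
    exact h.nonneg v hv hvn
  closing_nonneg := h.closing_nonneg
  closing_le := h.closing_le
  zero_le := by
    have := h.zero_le
    grind
  last_le := by
    have := h.last_le
    grind
  ends_add := by
    have := h.ends_add
    grind

theorem sum_Ico_add_ite_end {n w : ℕ} (hw : w = 0 ∨ w = n) (a : ℕ → ℤ) (r : ℤ) :
    ∑ v ∈ Ico 1 n, (a v + if v = w then r else 0) = ∑ v ∈ Ico 1 n, a v := by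
  refine sum_congr rfl fun v hv => ?_
  rw [mem_Ico] at hv
  rw [if_neg (by omega), add_zero]

theorem cycleExponents_add_image_endExponent {n : ℕ} (hn : 2 ≤ n) (N t u : ℕ) :
    cycleExponents n N t u + endExponent n '' {0, n} = cycleExponents n N t (u + 1) := by
  refine Set.Subset.antisymm (Set.add_subset_iff.2 ?_) ?_
  · rintro α ⟨e, a, ha, hN, hval⟩ _ ⟨w, hw : w = 0 ∨ w = n, rfl⟩
    have hle : a w + -1 ≤ e := by
      rcases hw with rfl | rfl
      exacts [by linarith [ha.zero_le], by linarith [ha.last_le]]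
    refine ⟨e, _, ha.add_ite_end (by omega) hw hle (by simp), ?_, fun v => ?_⟩
    · rwa [sum_Ico_add_ite_end hw]
    · have hv := hval v
      simp only [Finsupp.add_apply, endExponent, Finsupp.equivFunOnFinite_symm_apply_apply]
      grind
  · rintro α ⟨e, a, ha, hN, hval⟩
    obtain ⟨w, hw, hlt⟩ : ∃ w, (w = 0 ∨ w = n) ∧ a w < e := by
      by_contra! hge
      have hzero := hge 0 (.inl rfl)
      have hlast := hge n (.inr rfl)
      have hends := ha.ends_add
      omega
    obtain ⟨β, hβ, rfl⟩ := exists_add_eq_of_isCycleWeight (α := α) (g := endExponent n w) hn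
      (ha.add_ite_end (by omega) hw (Int.add_one_le_of_lt hlt) (Nat.cast_succ u).symm)
      ((congrArg _ (sum_Ico_add_ite_end hw a 1)).trans hN) fun v => by
        have hv := hval v
        simp only [endExponent, Finsupp.equivFunOnFinite_symm_apply_apply]
        grind
    exact Set.add_mem_add hβ ⟨w, hw, rfl⟩

section Ideals

variable (K : Type*) [Field K]

theorem pathIdealI_eq_monomialSpan (n : ℕ) :
    pathIdealI K n = monomialSpan K (Set.range (pathExponent n)) := by
  rw [pathIdealI, monomialSpan, ← Set.range_comp]
  exact congrArg (fun f => Ideal.span (Set.range f)) (funext (pathMonomial_eq_monomial K n))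

theorem pathIdealJ_eq_monomialSpan (n : ℕ) :
    pathIdealJ K n = monomialSpan K (pathExponent n '' {i | i.val ≠ 1}) := by
  rw [pathIdealJ, monomialSpan, Set.image_image]
  simp only [pathMonomial_eq_monomial]

theorem span_ends_eq_monomialSpan {n : ℕ} (hn : 2 ≤ n) :
    (Ideal.span {X ⟨0, by omega⟩, X ⟨n - 1, by omega⟩} : Ideal (MvPolynomial (Fin n) K)) =
      monomialSpan K (endExponent n '' {0, n}) := by
  rw [monomialSpan, Set.image_pair, Set.image_pair, endExponent_zero (by omega),
    endExponent_self (by omega)]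
  rfl

theorem pow_mul_pow_mul_pow_eq_monomialSpan {n : ℕ} (hn : 2 ≤ n) (s t u : ℕ) :
    pathIdealJ K n ^ s * pathIdealI K n ^ t *
        Ideal.span {X (⟨0, by omega⟩ : Fin n), X (⟨n - 1, by omega⟩ : Fin n)} ^ u =
      monomialSpan K (cycleExponents n (s + t) t u) := by
  induction u with
  | zero =>
    rw [pow_zero, mul_one]
    induction t with
    | zero =>
      rw [pow_zero, mul_one]
      induction s with
      | zero =>
        rw [cycleExponents_zero_zero_zero hn, monomialSpan, Set.image_singleton]
        exact Ideal.one_eq_top.trans Ideal.span_singleton_one.symm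
      | succ s ih =>
        rw [pow_succ, ih, pathIdealJ_eq_monomialSpan, monomialSpan_mul,
          cycleExponents_zero_add_image_pathExponent hn, add_right_comm]
    | succ t ih =>
      rw [pow_succ, ← mul_assoc, ih, pathIdealI_eq_monomialSpan, monomialSpan_mul,
        cycleExponents_add_range_pathExponent hn, add_assoc]
  | succ u ih =>
    rw [pow_succ, ← mul_assoc, ih, span_ends_eq_monomialSpan K hn, monomialSpan_mul,
      cycleExponents_add_image_endExponent hn]

end Ideals

end PathIdeals

theorem lemma4_general (K : Type*) [Field K] (n : ℕ) (hn : 2 ≤ n) (s t u : ℕ) :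
    HasLinearFreeResolution (pathIdealJ K n ^ s * pathIdealI K n ^ t *
      Ideal.span {X (⟨0, by omega⟩ : Fin n), X (⟨n - 1, by omega⟩ : Fin n)} ^ u) := by
  rw [pow_mul_pow_mul_pow_eq_monomialSpan K hn]
  exact ((isWeaklyPolymatroidal_cycleExponents hn (s + t) t u).hasLinearResolution
    fun _ => degree_of_mem_cycleExponents hn).hasLinearFreeResolution

theorem lemma4 (K : Type*) [Field K] (n : ℕ) (hn : 2 ≤ n) (s t : ℕ) :
    HasLinearFreeResolution (idealB K n s t) ∧ HasLinearFreeResolution (idealC K n hn s t) :=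
  ⟨by simpa [idealB] using lemma4_general K n hn s t 0,
    by simpa [idealC] using lemma4_general K n hn s 0 t⟩
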